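/- Let $k\ge 2$ be an integer. For an integer $m\ge 1$, an $m$-colouring of $\omega=\{0,1,2,\dots\}$ is a function $c:\omega\to\{1,\dots,m\}$ (an instance of $\mathsf{RT}^1_m$); a set $H\subseteq\omega$ is homogeneous for $c$ if $c$ is constant on $H$. Write $\mathbf{0}'$ for the Turing degree of the halting set $\emptyset'=\{e:\Phi_e(e)\downarrow\}$, where $\Phi_0,\Phi_1,\dots$ is a standard enumeration of the partial computable functions, and say that a set $G$ computes a set $H$ if $H\le_T G$. Then there exists a $\mathbf{0}'$-computable $k$-colouring $I_k$ of $\omega$ such that for every $(k-1)$-colouring $I_{k-1}$ of $\omega$ (computable or not) there exists an infinite set $G\subseteq\omega$, homogeneous for $I_{k-1}$, such that $G$ computes no infinite set that is homogeneous for $I_k$. -/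

import Mathlib

open scoped Computability

namespace RamseySingletons

/-- The characteristic function of `A ⊆ ℕ`, as a (total) function `ℕ →. ℕ`;
this is how a set is used as an oracle or as a result of a computation. -/
noncomputable def charFun (A : Set ℕ) : ℕ →. ℕ :=
  fun n => Part.some (A.indicator (fun _ => 1) n)

/-- `Computes A B`: the set `B` is Turing reducible to the set `A`. -/
def Computes (A B : Set ℕ) : Prop :=
  charFun B ≤ᵀ charFun A

/-- The jump of the empty set (the halting set): `e` belongs to it iff the `e`-th partial
recursive function is defined at `e`. -/
def zeroJump : Set ℕ :=
  {e | ((Denumerable.ofNat Nat.Partrec.Code e).eval e).Dom}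

/-- A `k`-colouring of the natural numbers, i.e. an instance of `RT^1_k`. -/
abbrev Colouring (k : ℕ) := ℕ → Fin k

/-- `H` is homogeneous for `c` if `c` is constant on `H`. -/
def Homogeneous {k : ℕ} (c : Colouring k) (H : Set ℕ) : Prop :=
  ∃ i : Fin k, ∀ x ∈ H, c x = i

/-- A nontrivial solution of the instance `c`: an infinite homogeneous set. -/
def IsSolution {k : ℕ} (c : Colouring k) (H : Set ℕ) : Prop :=
  H.Infinite ∧ Homogeneous c H

end RamseySingletons

/-! The colouring `I` consists of blocks coloured cyclically, whose ends are given by a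
`0'`-computable function dominating all computable ones. Hence a computable search started at the
beginning of a late block ends inside that block (`exists_fickle`), so its result can be forced to
have any prescribed colour.

Given `J` with fewer colours, Mathias-style forcing builds sets `G i` of points of `J`-colour i.
Reservoirs come in `Tame` classes: a search succeeding on every member has a common bound inside an
interval of prescribed `I`-colour. Tameness survives passing to relatively Π⁰₁ subclasses and
adjoining an arbitrary second coordinate over a finite alphabet, so the forcing can quantify over
all colourings in place of the possibly noncomputable `J`. For a colour j and functionals c i,
`Cond.Valid.exists_decides` ensures that for some i the functional c i with oracle `G i` either
accepts nothing beyond some n or accepts a point of `I`-colour j.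

For each j, one i then works for all functionals. As there are k values of j and k - 1 of i, two
values of j share an i. An infinite homogeneous set computed from that `G i` would have a colour
different from one of these two, a contradiction. -/

namespace RamseySingletons

/-- The total function `f` is recursive in `O`. -/
abbrev RecFun (O : Set (ℕ →. ℕ)) (f : ℕ → ℕ) : Prop :=
  Nat.RecursiveIn O fun n => Part.some (f n)

/-! ### Closure properties of total functions recursive in an oracle -/

namespace RecFun

variable {O : Set (ℕ →. ℕ)} {f g : ℕ → ℕ}

theorem of_primrec (hf : Primrec f) : RecFun O f :=
  Nat.Primrec.recursiveIn (Primrec.nat_iff.1 hf)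

theorem comp (hf : RecFun O f) (hg : RecFun O g) : RecFun O fun n => f (g n) :=
  (Nat.RecursiveIn.comp hf hg).of_eq fun n => by simp

theorem pair (hf : RecFun O f) (hg : RecFun O g) : RecFun O fun n => Nat.pair (f n) (g n) :=
  (Nat.RecursiveIn.pair hf hg).of_eq fun n => by simp [Seq.seq]

theorem comp₂ {h : ℕ → ℕ → ℕ} (hh : Primrec₂ h) (hf : RecFun O f) (hg : RecFun O g) :
    RecFun O fun n => h (f n) (g n) := by
  have := (of_primrec (O := O) (f := fun p => h p.unpair.1 p.unpair.2)
    (hh.comp (Primrec.fst.comp Primrec.unpair) (Primrec.snd.comp Primrec.unpair))).comp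
    (hf.pair hg)
  simpa using this

theorem natRec {b : ℕ → ℕ} {h : ℕ → ℕ} (hb : RecFun O b) (hh : RecFun O h) :
    RecFun O fun p => Nat.rec (motive := fun _ => ℕ) (b p.unpair.1)
      (fun y i => h (Nat.pair p.unpair.1 (Nat.pair y i))) p.unpair.2 := by
  refine (Nat.RecursiveIn.prec hb hh).of_eq fun p => ?_
  have key (a m : ℕ) : Nat.rec (motive := fun _ => Part ℕ) (Part.some (b a))
      (fun y IH => IH.bind fun i => Part.some (h (Nat.pair a (Nat.pair y i)))) m =
      Part.some (Nat.rec (motive := fun _ => ℕ) (b a)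
        (fun y i => h (Nat.pair a (Nat.pair y i))) m) := by
    induction m with
    | zero => rfl
    | succ m ih => simp [ih]
  exact key _ _

end RecFun

/-! ### Domination of computable functions by a `0'`-computable function -/

open Nat.Partrec (Code) in
open Classical in
/-- The value of the `p.unpair.1`-th partial recursive function at `p.unpair.2`, or `0` if it is
undefined there. -/
noncomputable def haltValue (p : ℕ) : ℕ :=
  if h : ((Denumerable.ofNat Code p.unpair.1).eval p.unpair.2).Dom then
    ((Denumerable.ofNat Code p.unpair.1).eval p.unpair.2).get h else 0

-- The code `Code.comp c (Code.const x)` ignores its input, so it halts on its own index iff c halts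
-- at x. The oracle's answer guards the evaluation, which is therefore never run on a divergent
-- computation.
open Nat.Partrec (Code) in
theorem recFun_haltValue : RecFun {charFun zeroJump} haltValue := by
  let t : ℕ → ℕ := fun p =>
    Encodable.encode (Code.comp (Denumerable.ofNat Code p.unpair.1) (Code.const p.unpair.2))
  have ht : Primrec t :=
    Primrec.encode.comp (Code.primrec₂_comp.comp
      ((Primrec.ofNat Code).comp (Primrec.fst.comp Primrec.unpair))
      (Code.primrec_const.comp (Primrec.snd.comp Primrec.unpair)))
  have htj (p : ℕ) : t p ∈ zeroJump ↔
      ((Denumerable.ofNat Code p.unpair.1).eval p.unpair.2).Dom := by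
    simp only [t, zeroJump, Set.mem_ofPred_eq, Denumerable.ofNat_encode, Code.eval, Code.eval_const]
    change (Part.bind (Part.some _) fun x => Code.eval _ x).Dom ↔ _
    rw [Part.bind_some]
  let Ψ : ℕ →. ℕ := fun q => Nat.casesOn (motive := fun _ => Part ℕ) q.unpair.2 (Part.some 0)
    fun _ => (Denumerable.ofNat Code q.unpair.1.unpair.1).eval q.unpair.1.unpair.2
  have hΨ : Nat.Partrec Ψ := by
    have c1 : Computable fun q : ℕ => q.unpair.1 := Computable.fst.comp Computable.unpair
    have c2 : Computable fun q : ℕ => q.unpair.2 := Computable.snd.comp Computable.unpair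
    have c : Partrec fun q : ℕ =>
        (Denumerable.ofNat Code q.unpair.1.unpair.1).eval q.unpair.1.unpair.2 :=
      Code.eval_part.comp ((Computable.ofNat Code).comp (c1.comp c1)) (c2.comp c1)
    exact Partrec.nat_iff.1 <| Partrec.nat_casesOn_right c2 (Computable.const 0)
      (c.comp Computable.fst).to₂
  have hχ : RecFun {charFun zeroJump} (zeroJump.indicator fun _ => 1) :=
    Nat.RecursiveIn.oracle _ rfl
  refine (Nat.RecursiveIn.comp hΨ.recursiveIn
    ((RecFun.of_primrec Primrec.id).pair (hχ.comp (RecFun.of_primrec ht)))).of_eq fun p => ?_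
  by_cases h : ((Denumerable.ofNat Code p.unpair.1).eval p.unpair.2).Dom
  · have h' := (htj p).2 h
    simp [Ψ, haltValue, h, h', Set.indicator_of_mem, Part.some_get]
  · have h' := mt (htj p).1 h
    simp [Ψ, haltValue, h, h', Set.indicator_of_notMem]

/-- A `0'`-computable function dominates all computable functions. -/
theorem exists_dominating : ∃ F : ℕ → ℕ, RecFun {charFun zeroJump} F ∧
    ∀ g : ℕ → ℕ, Computable g → ∃ N, ∀ n ≥ N, g n ≤ F n := by
  have p1 : Primrec fun p : ℕ => p.unpair.1 := Primrec.fst.comp Primrec.unpair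
  have p2 : Primrec fun p : ℕ => p.unpair.2 := Primrec.snd.comp Primrec.unpair
  -- Here q codes (n, (e, partial sum)); iterating `h` sums the values at n of the functions with
  -- index at most n.
  let h : ℕ → ℕ := fun q => q.unpair.2.unpair.2 +
    haltValue (Nat.pair q.unpair.2.unpair.1 q.unpair.1)
  have hh : RecFun {charFun zeroJump} h :=
    RecFun.comp₂ Primrec.nat_add (RecFun.of_primrec (p2.comp p2))
      (recFun_haltValue.comp (RecFun.of_primrec (Primrec₂.natPair.comp (p1.comp p2) p1)))
  have hF := ((RecFun.of_primrec (Primrec.const 0)).natRec hh).comp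
    (RecFun.of_primrec (Primrec₂.natPair.comp Primrec.id Primrec.succ))
  have key (n m : ℕ) : Nat.rec (motive := fun _ => ℕ) 0
      (fun y i => h (Nat.pair n (Nat.pair y i))) m =
      ∑ e ∈ Finset.range m, haltValue (Nat.pair e n) := by
    induction m with
    | zero => rfl
    | succ m ih => simp [h, Finset.sum_range_succ, ← ih]
  refine ⟨fun n => ∑ e ∈ Finset.range (n + 1), haltValue (Nat.pair e n), ?_, fun g hg => ?_⟩
  · refine hF.of_eq fun n => ?_
    simp only [Nat.unpair_pair, id, Nat.succ_eq_add_one, key]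
    simp [h, Finset.sum_range_succ, add_comm]
  · obtain ⟨c, hc⟩ := Nat.Partrec.Code.exists_code.1 (Partrec.nat_iff.1 hg.partrec)
    refine ⟨Encodable.encode c, fun n hn => ?_⟩
    have : haltValue (Nat.pair (Encodable.encode c) n) = g n := by
      simp [haltValue, hc]
    rw [← this]
    exact Finset.single_le_sum (f := fun e => haltValue (Nat.pair e n))
      (fun _ _ => Nat.zero_le _) (Finset.mem_range.2 (Nat.lt_succ_of_le hn))

/-! ### Fickle colourings -/

/-- Every primitive recursive search problem on intervals `[n, ℓ]` is solved by an interval on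
which `I` is constant with any prescribed colour. -/
def Fickle {k : ℕ} (I : Colouring k) : Prop :=
  ∀ R : ℕ → ℕ → Prop, PrimrecRel R → (∀ n, ∃ l, R n l) →
    ∀ j : Fin k, ∃ n l, R n l ∧ ∀ x, n ≤ x → x ≤ l → I x = j

theorem exists_computable_of_primrecRel {R : ℕ → ℕ → Prop} (hR : PrimrecRel R)
    (h : ∀ n, ∃ l, R n l) : ∃ g : ℕ → ℕ, Computable g ∧ ∀ n, R n (g n) := by
  obtain ⟨hdec, hR'⟩ := hR
  let _ : ∀ n l, Decidable (R n l) := fun n l => hdec (n, l)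
  have hp : Partrec fun n => Nat.rfind fun l => (Part.some (decide (R n l)) : Part Bool) :=
    Partrec.rfind (hR'.to_comp.partrec.to₂)
  have hd (n : ℕ) : (Nat.rfind fun l => (Part.some (decide (R n l)) : Part Bool)).Dom := by
    obtain ⟨l, hl⟩ := h n
    exact Nat.rfind_dom.2 ⟨l, by simpa using hl, fun _ => trivial⟩
  refine ⟨fun n => (Nat.rfind _).get (hd n), hp.of_eq_tot fun n => Part.get_mem _, fun n => ?_⟩
  simpa using Nat.rfind_spec (Part.get_mem (hd n))

/-- A block starting at n ends at max (F n) n, and block s gets colour s mod k. The solution g of a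
search problem satisfies g n ≤ F n for large n, so [n, g n] lies in one block. -/
theorem exists_fickle {k : ℕ} (hk : 0 < k) :
    ∃ I : Colouring k, ComputableIn {charFun zeroJump} I ∧ Fickle I := by
  obtain ⟨F, hF, hdom⟩ := exists_dominating
  -- A state is a pair (block index, bound on the block); q codes (y, state at y), and v is the
  -- bound used if y + 1 opens a new block.
  let G : ℕ → ℕ → ℕ := fun q v =>
    if q.unpair.1 + 1 ≤ q.unpair.2.unpair.2 then q.unpair.2
    else Nat.pair (q.unpair.2.unpair.1 + 1) v
  have p1 : Primrec fun p : ℕ => p.unpair.1 := Primrec.fst.comp Primrec.unpair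
  have p2 : Primrec fun p : ℕ => p.unpair.2 := Primrec.snd.comp Primrec.unpair
  have hG : Primrec₂ G := by
    refine Primrec.ite (Primrec.nat_le.comp (Primrec.succ.comp (p1.comp Primrec.fst))
      (p2.comp (p2.comp Primrec.fst))) (p2.comp Primrec.fst)
      (Primrec₂.natPair.comp (Primrec.succ.comp (p1.comp (p2.comp Primrec.fst))) Primrec.snd)
  let st : ℕ → ℕ := fun x => Nat.rec (motive := fun _ => ℕ) (Nat.pair 0 (F 0))
    (fun y i => G (Nat.pair y i) (F (y + 1))) x
  have hst : RecFun {charFun zeroJump} st := by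
    have hh : RecFun {charFun zeroJump} fun q => G q.unpair.2 (F (q.unpair.2.unpair.1 + 1)) :=
      RecFun.comp₂ hG (RecFun.of_primrec p2)
        (hF.comp (RecFun.of_primrec (Primrec.succ.comp (p1.comp p2))))
    have := ((RecFun.of_primrec (Primrec.const (Nat.pair 0 (F 0)))).natRec hh).comp
      (RecFun.of_primrec (Primrec₂.natPair.comp (Primrec.const 0) Primrec.id))
    simpa [st] using this
  have hsucc (x : ℕ) : st (x + 1) = if x + 1 ≤ (st x).unpair.2 then st x
      else Nat.pair ((st x).unpair.1 + 1) (F (x + 1)) := by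
    simp [st, G]
  -- The start of block s. The maximum covers F n < n, where the block is the single point n.
  let ns : ℕ → ℕ := fun s => Nat.rec (motive := fun _ => ℕ) 0 (fun _ n => max (F n) n + 1) s
  have hns (s : ℕ) : ns (s + 1) = max (F (ns s)) (ns s) + 1 := rfl
  have hge (s : ℕ) : s ≤ ns s := by
    induction s with
    | zero => exact Nat.zero_le _
    | succ s ih => rw [hns]; omega
  have hconst (s : ℕ) (h0 : st (ns s) = Nat.pair s (F (ns s))) (d : ℕ)
      (hd : ns s + d ≤ max (F (ns s)) (ns s)) : st (ns s + d) = Nat.pair s (F (ns s)) := by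
    induction d with
    | zero => exact h0
    | succ d ih =>
      rw [← add_assoc, hsucc, ih (by omega), if_pos]
      simp only [Nat.unpair_pair]
      omega
  have hstart (s : ℕ) : st (ns s) = Nat.pair s (F (ns s)) := by
    induction s with
    | zero => rfl
    | succ s ih =>
      have := hconst s ih (max (F (ns s)) (ns s) - ns s) (by omega)
      rw [Nat.add_sub_cancel' (le_max_right _ _)] at this
      rw [hns, hsucc, this, if_neg]
      · simp
      · simp only [Nat.unpair_pair]
        omega
  refine ⟨fun x => ⟨(st x).unpair.1 % k, Nat.mod_lt _ hk⟩, ?_, fun R hR hex j => ?_⟩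
  · have := (RecFun.of_primrec (O := {charFun zeroJump})
      (Primrec.nat_mod.comp p1 (Primrec.const k))).comp hst
    unfold ComputableIn RecursiveIn
    refine this.of_eq fun n => ?_
    simp only [Encodable.decode_nat, Part.coe_some, Part.bind_some, Part.map_some]
    rfl
  · obtain ⟨g, hg, hRg⟩ := exists_computable_of_primrecRel hR hex
    obtain ⟨N, hN⟩ := hdom g hg
    -- This s is congruent to j mod k and at least N, so block s has colour j and starts beyond N.
    set s := N * k + j with hs
    have hNs : N ≤ ns s := by
      have : N ≤ N * k := Nat.le_mul_of_pos_right _ hk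
      have := hge s
      omega
    refine ⟨ns s, g (ns s), hRg _, fun x hx hx' => ?_⟩
    have h1 := hN _ hNs
    have h2 := hconst s (hstart s) (x - ns s) (by omega)
    rw [Nat.add_sub_cancel' hx] at h2
    ext
    simp [h2, hs, Nat.mod_eq_of_lt j.2]


/-! ### Finite strings and compactness -/

section Strings

variable {α β : Type}

/-- The initial segment of length `l` of a sequence. -/
def pre (X : ℕ → α) (l : ℕ) : List α := (List.range l).map X

@[simp] theorem length_pre (X : ℕ → α) (l : ℕ) : (pre X l).length = l := by simp [pre]

theorem getD_pre (X : ℕ → α) {l x : ℕ} (h : x < l) (d : α) : (pre X l).getD x d = X x := by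
  simp [pre, h]

theorem pre_congr {X Y : ℕ → α} {l : ℕ} (h : ∀ x < l, X x = Y x) : pre X l = pre Y l :=
  List.map_congr_left fun x hx => h x (List.mem_range.1 hx)

theorem take_pre (X : ℕ → α) {l m : ℕ} (h : l ≤ m) : (pre X m).take l = pre X l := by
  simp [pre, ← List.map_take, List.take_range, h]

/-- All strings of length `n` over the alphabet `L`. -/
def stringsOfLength (L : List β) (n : ℕ) : List (List β) :=
  n.rec [[]] fun _ S => S.flatMap fun s => L.map fun b => b :: s

theorem mem_stringsOfLength {L : List β} (hL : ∀ b, b ∈ L) {n : ℕ} {s : List β} :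
    s ∈ stringsOfLength L n ↔ s.length = n := by
  induction n generalizing s with
  | zero => simp [stringsOfLength]
  | succ n ih =>
    have : stringsOfLength L (n + 1) =
      (stringsOfLength L n).flatMap fun s => L.map fun b => b :: s := rfl
    rw [this]
    cases s <;> simp [ih, hL]

theorem primrec_stringsOfLength [Primcodable β] (L : List β) : Primrec (stringsOfLength L) := by
  refine Primrec.nat_rec₁ 
    (f := fun _ (S : List (List β)) => S.flatMap fun s => L.map fun b => b :: s) [[]] ?_
  refine Primrec.list_flatMap Primrec.snd ?_
  exact Primrec.list_map (Primrec.const L)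
    (Primrec.list_cons.comp Primrec.snd (Primrec.snd.comp Primrec.fst))

/-- Compactness of the space of sequences over a finite alphabet. -/
theorem exists_uniform_bound [Finite β] {W : ℕ → (ℕ → β) → Prop}
    (hW : ∀ l c d, (∀ x < l, c x = d x) → W l c → W l d) (h : ∀ c, ∃ l, W l c) :
    ∃ L, ∀ c, ∃ l ≤ L, W l c := by
  let _ : TopologicalSpace β := ⊥
  have : DiscreteTopology β := ⟨rfl⟩
  have hopen (l : ℕ) : IsOpen {c | W l c} := by
    refine isOpen_iff_mem_nhds.2 fun c hc => ?_
    have : {d : ℕ → β | ∀ x ∈ Finset.range l, d x ∈ ({c x} : Set β)} ∈ nhds c := by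
      refine IsOpen.mem_nhds ?_ (by simp)
      exact isOpen_set_pi (Finset.finite_toSet _) fun _ _ => isOpen_discrete _
    filter_upwards [this] with d hd
    exact hW l c d (fun x hx => (hd x (Finset.mem_range.2 hx)).symm) hc
  obtain ⟨t, ht⟩ := isCompact_univ.elim_finite_subcover (fun l => {c | W l c}) hopen
    fun c _ => Set.mem_iUnion.2 (h c)
  refine ⟨t.sup id, fun c => ?_⟩
  obtain ⟨l, hl, hc⟩ := Set.mem_iUnion₂.1 (ht (Set.mem_univ c))
  exact ⟨l, Finset.le_sup (f := id) hl, hc⟩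

end Strings

/-! ### Bounded quantifiers over primitive recursive predicates -/

section PrimrecLemmas

variable {α β : Type} [Primcodable α] [Primcodable β]

theorem PrimrecRel.exists_mem {R : α → β → Prop} {f : α → List β} (hR : PrimrecRel R)
    (hf : Primrec f) : PrimrecPred fun a => ∃ b ∈ f a, R a b :=
  ((PrimrecRel.exists_mem_list hR.swap).comp hf Primrec.id).of_eq fun _ => Iff.rfl

theorem PrimrecRel.exists_le {R : α → ℕ → Prop} {f : α → ℕ} (hR : PrimrecRel R) (hf : Primrec f) :
    PrimrecPred fun a => ∃ l ≤ f a, R a l :=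
  (PrimrecRel.exists_mem hR (Primrec.list_range.comp (Primrec.succ.comp hf))).of_eq fun a => by simp

theorem PrimrecRel.forall_mem {R : α → β → Prop} {f : α → List β} (hR : PrimrecRel R)
    (hf : Primrec f) : PrimrecPred fun a => ∀ b ∈ f a, R a b :=
  ((PrimrecRel.forall_mem_list hR.swap).comp hf Primrec.id).of_eq fun _ => Iff.rfl

theorem PrimrecPred.const (p : Prop) : PrimrecPred fun _ : α => p := by
  classical exact ⟨fun _ => inferInstance, Primrec.const _⟩

theorem PrimrecPred.finite_exists {ι : Type} (S : Finset ι) {p : ι → α → Prop}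
    (h : ∀ i ∈ S, PrimrecPred (p i)) : PrimrecPred fun a => ∃ i ∈ S, p i a := by
  classical
  induction S using Finset.induction_on with
  | empty => exact (PrimrecPred.const False).of_eq fun _ => by simp
  | insert i S _ ih =>
    exact ((h i (Finset.mem_insert_self _ _)).or
      (ih fun j hj => h j (Finset.mem_insert_of_mem hj))).of_eq fun _ => by simp

theorem PrimrecPred.of_finite [Finite α] (p : α → Prop) : PrimrecPred p := by
  classical exact ⟨fun _ => inferInstance, Primrec.dom_finite _⟩

end PrimrecLemmas

/-! ### Tame classes and their closure properties -/

section Tame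

variable {k : ℕ} (I : Colouring k) {α β : Type} [Primcodable α] [Primcodable β]

/-- A class `P` of sequences is tame for the colouring `I` if every primitive recursive property
that holds of some initial segment of each member of `P` does so with a uniform bound `g`, for some
parameter `n` such that `I` takes a prescribed constant value on `[n, g]`. -/
def Tame (P : Set (ℕ → α)) : Prop :=
  ∀ U : List α → ℕ → Prop, PrimrecRel U → (∀ n, ∀ X ∈ P, ∃ l, U (pre X l) n) →
    ∀ j : Fin k, ∃ n g, (∀ x, n ≤ x → x ≤ g → I x = j) ∧ ∀ X ∈ P, ∃ l ≤ g, U (pre X l) n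

variable {I}

/-- With a single computable sequence, tameness is just fickleness; all other tame classes are
derived from this one. -/
theorem tame_singleton_const (hI : Fickle I) (a : α) : Tame I {fun _ : ℕ => a} := by
  intro U hU h j
  have hp : Primrec fun l : ℕ => pre (fun _ => a) l :=
    Primrec.list_map Primrec.list_range (Primrec₂.const a)
  obtain ⟨n, l, hl, hc⟩ := hI (fun n l => U (pre (fun _ => a) l) n)
    (hU.comp (hp.comp Primrec.snd) Primrec.fst) (fun n => h n _ rfl) j
  exact ⟨n, l, hc, by rintro X rfl; exact ⟨l, le_rfl, hl⟩⟩

/-- The search for U or V succeeds on discarded sequences through V; on the remaining ones only U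
can have succeeded. -/
theorem Tame.restrict {P : Set (ℕ → α)} (hP : Tame I P) {V : List α → Prop} (hV : PrimrecPred V) :
    Tame I {X ∈ P | ∀ l, ¬ V (pre X l)} := by
  intro U hU h j
  obtain ⟨n, g, hc, hg⟩ := hP (fun s n => U s n ∨ V s) (hU.or (hV.comp Primrec.fst))
    (fun n X hX => by
      by_cases hv : ∃ l, V (pre X l)
      · exact hv.imp fun _ => Or.inr
      · exact (h n X ⟨hX, not_exists.1 hv⟩).imp fun _ => Or.inl) j
  refine ⟨n, g, hc, fun X hX => ?_⟩
  obtain ⟨l, hl, hu⟩ := hg X hX.1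
  exact ⟨l, hl, hu.resolve_right (hX.2 l)⟩

theorem Tame.image {P : Set (ℕ → α)} (hP : Tame I P) {Φ : (ℕ → α) → ℕ → β} {φ : List α → List β}
    (hφ : Primrec φ) (h : ∀ X l, φ (pre X l) = pre (Φ X) l) : Tame I (Φ '' P) := by
  intro U hU hex j
  obtain ⟨n, g, hc, hg⟩ := hP (fun s n => U (φ s) n) (hU.comp (hφ.comp Primrec.fst) Primrec.snd)
    (fun n X hX => by simpa [h] using hex n _ ⟨X, hX, rfl⟩) j
  refine ⟨n, g, hc, ?_⟩
  rintro _ ⟨X, hX, rfl⟩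
  simpa [h] using hg X hX

/-- Search for a length at which every string over `β` has been caught by U. By compactness this
succeeds for each first coordinate, and it mentions only that coordinate. -/
theorem Tame.prod [Finite β] [Inhabited α] [Inhabited β] {P : Set (ℕ → α)} (hP : Tame I P) :
    Tame I {Z : ℕ → α × β | (fun x => (Z x).1) ∈ P} := by
  intro U hU h j
  obtain ⟨L, hL⟩ : ∃ L : List β, ∀ b, b ∈ L := by
    have := Fintype.ofFinite β
    exact ⟨Finset.univ.toList, by simp⟩
  let zip : List α → List β → ℕ → List (α × β) := fun s c l =>
    (List.range l).map fun x => (s.getD x default, c.getD x default)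
  have hzip (X : ℕ → α) (c : ℕ → β) {l m : ℕ} (hl : l ≤ m) :
      zip (pre X m) (pre c m) l = pre (fun x => (X x, c x)) l :=
    pre_congr fun x hx => by rw [getD_pre _ (hx.trans_le hl), getD_pre _ (hx.trans_le hl)]
  have hzp : Primrec fun p : (List α × List β) × ℕ => zip p.1.1 p.1.2 p.2 := by
    refine Primrec.list_map (Primrec.list_range.comp Primrec.snd) ?_
    exact Primrec.pair
      ((Primrec.list_getD _).comp (Primrec.fst.comp (Primrec.fst.comp Primrec.fst)) Primrec.snd)
      ((Primrec.list_getD _).comp (Primrec.snd.comp (Primrec.fst.comp Primrec.fst)) Primrec.snd)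
  let U' : List α → ℕ → Prop := fun s n =>
    ∀ c ∈ stringsOfLength L s.length, ∃ l ≤ s.length, U (zip s c l) n
  have hU' : PrimrecRel U' := by
    refine PrimrecRel.forall_mem
      (R := fun (p : List α × ℕ) c => ∃ l ≤ p.1.length, U (zip p.1 c l) p.2) ?_
      ((primrec_stringsOfLength L).comp (Primrec.list_length.comp Primrec.fst))
    refine PrimrecRel.exists_le
      (R := fun (p : (List α × ℕ) × List β) l => U (zip p.1.1 p.2 l) p.1.2) ?_
      (Primrec.list_length.comp (Primrec.fst.comp Primrec.fst))
    exact hU.comp (hzp.comp (Primrec.pair (Primrec.pair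
      (Primrec.fst.comp (Primrec.fst.comp Primrec.fst)) (Primrec.snd.comp Primrec.fst))
      Primrec.snd)) (Primrec.snd.comp (Primrec.fst.comp Primrec.fst))
  obtain ⟨n, g, hc, hg⟩ := hP U' hU' (fun n X hX => by
    obtain ⟨m, hm⟩ := exists_uniform_bound (W := fun l c => U (pre (fun x => (X x, c x)) l) n)
      (fun l c d hcd => by rw [pre_congr fun x hx => by rw [hcd x hx]]; exact id)
      (fun c => h n (fun x => (X x, c x)) hX)
    refine ⟨m, fun c hc => ?_⟩
    rw [mem_stringsOfLength hL, length_pre] at hc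
    obtain ⟨l, hl, hu⟩ := hm fun x => c.getD x default
    have hcp : c = pre (fun x => c.getD x default) m := by
      apply List.ext_getElem (by simp [hc])
      intro x h1 h2
      simp [pre, h1]
    refine ⟨l, by simpa using hl, ?_⟩
    rw [hcp, hzip _ _ hl]
    exact hu) j
  refine ⟨n, g, hc, fun Z hZ => ?_⟩
  obtain ⟨m, hm, hu⟩ := hg _ hZ
  obtain ⟨l, hl, hu⟩ := hu (pre (fun x => (Z x).2) m) (by simp [mem_stringsOfLength hL])
  rw [length_pre] at hl
  rw [hzip _ _ hl] at hu
  exact ⟨l, hl.trans hm, hu⟩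

end Tame

/-! ### Oracle computations as functionals on finite strings -/

open Nat.Partrec (Code)

/-- `ψ` is a partial recursive monotone functional whose value on the oracle `X` is `f`. -/
structure Represents (X : ℕ → Bool) (ψ : List Bool → ℕ → Part ℕ) (f : ℕ → Part ℕ) : Prop where
  partrec : Partrec₂ ψ
  mono : ∀ {l m n a}, l ≤ m → a ∈ ψ (pre X l) n → a ∈ ψ (pre X m) n
  mem_iff : ∀ {n a}, a ∈ f n ↔ ∃ l, a ∈ ψ (pre X l) n

theorem Represents.of_partrec {X : ℕ → Bool} {f : ℕ →. ℕ} (hf : Nat.Partrec f) :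
    Represents X (fun _ => f) f where
  partrec := (Partrec.nat_iff.2 hf).comp Computable.snd
  mono _ := id
  mem_iff := by simp

theorem Represents.oracle (X : ℕ → Bool) :
    Represents X (fun s n => (s[n]? : Option Bool).map fun b => cond b 1 0)
      (fun n => Part.some (cond (X n) 1 0)) where
  partrec := by
    have : Primrec fun p : List Bool × ℕ => (p.1[p.2]?).map fun b => cond b 1 0 :=
      Primrec.option_map Primrec.list_getElem? ((Primrec.dom_finite fun b => cond b 1 0).comp
        Primrec.snd)
    exact Computable.ofOption this.to_comp
  mono {l m n a} h := by
    simp only [pre, Part.mem_coe]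
    by_cases hn : n < l
    · simp [hn, hn.trans_le h]
    · simp [hn]
  mem_iff {n a} := by
    simp only [pre, Part.mem_coe]
    constructor
    · intro h
      exact ⟨n + 1, by simpa [eq_comm] using h⟩
    · rintro ⟨l, hl⟩
      by_cases hn : n < l
      · simpa [hn, eq_comm] using hl
      · simp [hn] at hl

variable {X : ℕ → Bool} {ψ χ : List Bool → ℕ → Part ℕ} {f h : ℕ → Part ℕ}

theorem Represents.pair (hf : Represents X ψ f) (hh : Represents X χ h) :
    Represents X (fun s n => (ψ s n).bind fun a => (χ s n).map fun b => Nat.pair a b)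
      (fun n => Nat.pair <$> f n <*> h n) where
  partrec := by
    refine Partrec.bind hf.partrec ?_
    exact Partrec.map (hh.partrec.comp (Computable.fst.comp Computable.fst)
      (Computable.snd.comp Computable.fst))
      (Primrec₂.natPair.to_comp.comp (Computable.snd.comp Computable.fst) Computable.snd)
  mono hl := by
    simp only [Part.mem_bind_iff, Part.mem_map_iff]
    rintro ⟨a, ha, b, hb, rfl⟩
    exact ⟨a, hf.mono hl ha, b, hh.mono hl hb, rfl⟩
  mem_iff {n c} := by
    simp only [Part.mem_bind_iff, Part.mem_map_iff, Seq.seq, Part.map_eq_map, hf.mem_iff,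
      hh.mem_iff]
    constructor
    · rintro ⟨_, ⟨a, ⟨l, ha⟩, rfl⟩, b, ⟨m, hb⟩, rfl⟩
      exact ⟨max l m, a, hf.mono (le_max_left _ _) ha, b, hh.mono (le_max_right _ _) hb, rfl⟩
    · rintro ⟨l, a, ha, b, hb, rfl⟩
      exact ⟨_, ⟨a, ⟨l, ha⟩, rfl⟩, b, ⟨l, hb⟩, rfl⟩

theorem Represents.comp (hf : Represents X ψ f) (hh : Represents X χ h) :
    Represents X (fun s n => (χ s n).bind fun a => ψ s a) (fun n => (h n).bind fun a => f a) where
  partrec := Partrec.bind hh.partrec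
    (hf.partrec.comp (Computable.fst.comp Computable.fst) Computable.snd)
  mono hl := by
    simp only [Part.mem_bind_iff]
    rintro ⟨a, ha, hb⟩
    exact ⟨a, hh.mono hl ha, hf.mono hl hb⟩
  mem_iff {n c} := by
    simp only [Part.mem_bind_iff, hf.mem_iff, hh.mem_iff]
    constructor
    · rintro ⟨a, ⟨l, ha⟩, m, hb⟩
      exact ⟨max l m, a, hh.mono (le_max_left _ _) ha, hf.mono (le_max_right _ _) hb⟩
    · rintro ⟨l, a, ha, hb⟩
      exact ⟨a, ⟨l, ha⟩, l, hb⟩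

theorem Represents.prec (hf : Represents X ψ f) (hh : Represents X χ h) :
    Represents X
      (fun s p => Nat.rec (motive := fun _ => Part ℕ) (ψ s p.unpair.1)
        (fun y IH => IH.bind fun i => χ s (Nat.pair p.unpair.1 (Nat.pair y i))) p.unpair.2)
      (fun p => Nat.rec (motive := fun _ => Part ℕ) (f p.unpair.1)
        (fun y IH => IH.bind fun i => h (Nat.pair p.unpair.1 (Nat.pair y i))) p.unpair.2) := by
  have mono {l m a d v} (hl : l ≤ m) :
      v ∈ Nat.rec (motive := fun _ => Part ℕ) (ψ (pre X l) a)
        (fun y IH => IH.bind fun i => χ (pre X l) (Nat.pair a (Nat.pair y i))) d →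
      v ∈ Nat.rec (motive := fun _ => Part ℕ) (ψ (pre X m) a)
        (fun y IH => IH.bind fun i => χ (pre X m) (Nat.pair a (Nat.pair y i))) d := by
    induction d generalizing v with
    | zero => exact hf.mono hl
    | succ d ih =>
      simp only [Part.mem_bind_iff]
      rintro ⟨i, hi, hv⟩
      exact ⟨i, ih hi, hh.mono hl hv⟩
  refine ⟨?_, fun hl => mono hl, fun {p v} => ?_⟩
  · have c1 : Computable fun q : List Bool × ℕ => q.2.unpair.1 :=
      Computable.fst.comp (Computable.unpair.comp Computable.snd)
    have c2 : Computable fun q : List Bool × ℕ => q.2.unpair.2 :=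
      Computable.snd.comp (Computable.unpair.comp Computable.snd)
    refine Partrec.nat_rec c2 (hf.partrec.comp Computable.fst c1)
      (h := fun q r => χ q.1 (Nat.pair q.2.unpair.1 (Nat.pair r.1 r.2))) ?_
    exact hh.partrec.comp (Computable.fst.comp Computable.fst)
      (Primrec₂.natPair.to_comp.comp (c1.comp Computable.fst)
        (Primrec₂.natPair.to_comp.comp (Computable.fst.comp Computable.snd)
          (Computable.snd.comp Computable.snd)))
  · generalize p.unpair.1 = a
    generalize p.unpair.2 = d
    induction d generalizing v with
    | zero => exact hf.mem_iff
    | succ d ih =>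
      simp only [Part.mem_bind_iff, ih, hh.mem_iff]
      constructor
      · rintro ⟨i, ⟨l, hi⟩, m, hv⟩
        exact ⟨max l m, i, mono (le_max_left _ _) hi, hh.mono (le_max_right _ _) hv⟩
      · rintro ⟨l, i, hi, hv⟩
        exact ⟨i, ⟨l, hi⟩, l, hv⟩

theorem mem_rfind_map {p : ℕ → Part ℕ} {n : ℕ} :
    (n ∈ Nat.rfind fun n => (p n).map fun m => decide (m = 0)) ↔
      0 ∈ p n ∧ ∀ m < n, ∃ c ∈ p m, c ≠ 0 := by
  refine Nat.mem_rfind.trans (and_congr ?_ (forall₂_congr fun m _ => ?_)) <;>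
    exact (Part.mem_map_iff _).trans (by simp)

theorem Represents.rfind (hf : Represents X ψ f) :
    Represents X
      (fun s a => Nat.rfind fun n => (ψ s (Nat.pair a n)).map fun m => decide (m = 0))
      (fun a => Nat.rfind fun n => (f (Nat.pair a n)).map fun m => decide (m = 0)) where
  partrec := by
    refine Partrec.rfind (Partrec.map (hf.partrec.comp (Computable.fst.comp Computable.fst)
      (Primrec₂.natPair.to_comp.comp (Computable.snd.comp Computable.fst) Computable.snd)) ?_)
    exact (Primrec.eq.decide.comp Primrec.snd (Primrec.const 0)).to_comp
  mono {l m a n} hl h := by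
    obtain ⟨h0, h⟩ := mem_rfind_map.1 h
    exact mem_rfind_map.2 ⟨hf.mono hl h0, fun m hm => (h m hm).imp fun c hc =>
      ⟨hf.mono hl hc.1, hc.2⟩⟩
  mem_iff {a n} := by
    constructor
    · intro h
      obtain ⟨h0, h⟩ := mem_rfind_map.1 h
      obtain ⟨l, hl⟩ := hf.mem_iff.1 h0
      -- One prefix must serve all the finitely many values tested before n.
      have : ∀ d, d ≤ n → ∃ L, ∀ m < d, ∃ c ∈ ψ (pre X L) (Nat.pair a m), c ≠ 0 := by
        intro d
        induction d with
        | zero => intro; exact ⟨0, fun m hm => absurd hm (Nat.not_lt_zero m)⟩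
        | succ d ih =>
          intro hd
          obtain ⟨L, hL⟩ := ih (by omega)
          obtain ⟨c, hc, h1⟩ := h d hd
          obtain ⟨l, hc⟩ := hf.mem_iff.1 hc
          refine ⟨max L l, fun m hm => ?_⟩
          rcases Nat.lt_succ_iff_lt_or_eq.1 hm with hm | rfl
          · exact (hL m hm).imp fun c hc => ⟨hf.mono (le_max_left _ _) hc.1, hc.2⟩
          · exact ⟨c, hf.mono (le_max_right _ _) hc, h1⟩
      obtain ⟨L, hL⟩ := this n le_rfl
      exact ⟨max l L, mem_rfind_map.2 ⟨hf.mono (le_max_left _ _) hl, fun m hm =>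
        (hL m hm).imp fun c hc => ⟨hf.mono (le_max_right _ _) hc.1, hc.2⟩⟩⟩
    · rintro ⟨l, h⟩
      obtain ⟨h0, h⟩ := mem_rfind_map.1 h
      exact mem_rfind_map.2 ⟨hf.mem_iff.2 ⟨l, h0⟩, fun m hm => (h m hm).imp fun c hc =>
        ⟨hf.mem_iff.2 ⟨l, hc.1⟩, hc.2⟩⟩

/-- The use principle: a convergent oracle computation consults only a finite part of the oracle. -/
theorem exists_represents {X : ℕ → Bool} {f : ℕ →. ℕ}
    (hf : Nat.RecursiveIn {fun n => Part.some (cond (X n) 1 0)} f) : ∃ ψ, Represents X ψ f := by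
  induction hf with
  | zero => exact ⟨_, .of_partrec .zero⟩
  | succ => exact ⟨_, .of_partrec .succ⟩
  | left => exact ⟨_, .of_partrec .left⟩
  | right => exact ⟨_, .of_partrec .right⟩
  | oracle g hg =>
    rw [Set.mem_singleton_iff.1 hg]
    exact ⟨_, .oracle X⟩
  | pair _ _ ih₁ ih₂ => exact ⟨_, ih₁.choose_spec.pair ih₂.choose_spec⟩
  | comp _ _ ih₁ ih₂ => exact ⟨_, ih₁.choose_spec.comp ih₂.choose_spec⟩
  | prec _ _ ih₁ ih₂ => exact ⟨_, ih₁.choose_spec.prec ih₂.choose_spec⟩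
  | rfind _ ih => exact ⟨_, ih.choose_spec.rfind⟩

/-- Within `|s|` steps, the functional with code `c` and oracle `s` accepts some element of
`[n, |s|]`. -/
def AcceptsAbove (c : Code) (s : List Bool) (n : ℕ) : Prop :=
  ∃ x ≤ s.length, n ≤ x ∧ ∃ l ≤ s.length,
    Code.evaln s.length c (Encodable.encode (s.take l, x)) = some 1

theorem primrecRel_acceptsAbove (c : Code) : PrimrecRel (AcceptsAbove c) := by
  refine PrimrecRel.exists_le (R := fun (p : List Bool × ℕ) x => p.2 ≤ x ∧
    ∃ l ≤ p.1.length, Code.evaln p.1.length c (Encodable.encode (p.1.take l, x)) = some 1) ?_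
    (Primrec.list_length.comp Primrec.fst)
  refine (Primrec.nat_le.comp (Primrec.snd.comp Primrec.fst) Primrec.snd).and ?_
  refine PrimrecRel.exists_le (R := fun (p : (List Bool × ℕ) × ℕ) l =>
    Code.evaln p.1.1.length c (Encodable.encode (p.1.1.take l, p.2)) = some 1) ?_
    (Primrec.list_length.comp (Primrec.fst.comp Primrec.fst))
  have hs : Primrec fun q : ((List Bool × ℕ) × ℕ) × ℕ => q.1.1.1 :=
    Primrec.fst.comp (Primrec.fst.comp Primrec.fst)
  refine Primrec.eq.comp (Code.primrec_evaln.comp (Primrec.pair (Primrec.pair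
    (Primrec.list_length.comp hs) (Primrec.const c)) (Primrec.encode.comp (Primrec.pair
      (Primrec.list_take.comp Primrec.snd hs) (Primrec.snd.comp Primrec.fst)))))
    (Primrec.const (some 1))

/-- A set computable from `X` has a code `c` such that `AcceptsAbove c` searches for its
elements. -/
theorem exists_code_acceptsAbove {X : ℕ → Bool} {H : Set ℕ} (h : Computes {x | X x = true} H) :
    ∃ c : Code, (∀ n x, x ∈ H → n ≤ x → ∃ l, AcceptsAbove c (pre X l) n) ∧
      ∀ n l, AcceptsAbove c (pre X l) n → ∃ x ∈ H, n ≤ x ∧ x ≤ l := by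
  have hX : charFun {x | X x = true} = fun n => Part.some (cond (X n) 1 0) := by
    funext n
    cases hn : X n <;> simp [charFun, hn]
  have h' : Nat.RecursiveIn {fun n => Part.some (cond (X n) 1 0)} (charFun H) := by
    rw [← hX]
    exact RecursiveIn.iff_nat.1 h
  obtain ⟨ψ, hψ⟩ := exists_represents h'
  obtain ⟨c, hc⟩ := Code.exists_code.1 hψ.partrec
  have hev (s : List Bool) (x a : ℕ) : a ∈ c.eval (Encodable.encode (s, x)) ↔ a ∈ ψ s x := by
    rw [hc]
    simp [Encodable.encodek]
  have hmem (x : ℕ) : 1 ∈ charFun H x ↔ x ∈ H := by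
    by_cases hx : x ∈ H <;> simp [charFun, hx]
  refine ⟨c, fun n x hx hn => ?_, fun n l ha => ?_⟩
  · obtain ⟨l, hl⟩ := hψ.mem_iff.1 ((hmem x).2 hx)
    obtain ⟨t, ht⟩ := Code.evaln_complete.1 ((hev _ _ _).2 hl)
    -- The oracle prefix keeps length l while the whole string grows to allow t steps; this is why
    -- `AcceptsAbove` quantifies over prefixes.
    have hlm : l ≤ max l (max x t) := le_max_left _ _
    refine ⟨max l (max x t), x, by simp, hn, l, by simp, ?_⟩
    rw [take_pre _ hlm, length_pre]
    exact Code.evaln_mono (by simp) ht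
  · obtain ⟨x, hx, hn, i, hi, he⟩ := ha
    rw [length_pre] at hx hi
    rw [take_pre _ hi] at he
    exact ⟨x, (hmem x).1 (hψ.mem_iff.2 ⟨i, (hev _ _ _).1 (Code.evaln_sound he)⟩), hn, hx⟩


/-! ### Termwise operations on tame classes -/

section TameExtras

variable {k : ℕ} {I : Colouring k} {α β : Type} [Primcodable α] [Primcodable β]

theorem Tame.map [Inhabited α] {P : Set (ℕ → α)} (hP : Tame I P) {θ : ℕ → α → β}
    (hθ : Primrec₂ θ) : Tame I ((fun X x => θ x (X x)) '' P) := by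
  refine hP.image (φ := fun s => (List.range s.length).map fun x => θ x (s.getD x default)) ?_ ?_
  · exact Primrec.list_map (Primrec.list_range.comp Primrec.list_length)
      (hθ.comp Primrec.snd ((Primrec.list_getD _).comp Primrec.fst Primrec.snd))
  · intro X l
    rw [length_pre]
    exact pre_congr fun x hx => by rw [getD_pre _ hx]

/-- Restriction to sequences all of whose terms satisfy a primitive recursive condition. -/
theorem Tame.forall_term [Inhabited α] {P : Set (ℕ → α)} (hP : Tame I P) {A : ℕ → α → Prop}
    (hA : PrimrecRel A) : Tame I {X ∈ P | ∀ x, A x (X x)} := by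
  have hV : PrimrecPred fun s : List α => ∃ x ∈ List.range s.length, ¬ A x (s.getD x default) :=
    PrimrecRel.exists_mem (R := fun (s : List α) x => ¬ A x (s.getD x default))
      (hA.comp Primrec.snd ((Primrec.list_getD _).comp Primrec.fst Primrec.snd)).not
      (Primrec.list_range.comp Primrec.list_length)
  have := hP.restrict hV
  convert this using 4 with X
  constructor
  · rintro h l ⟨x, hx, hn⟩
    rw [length_pre, List.mem_range] at hx
    rw [getD_pre _ hx] at hn
    exact hn (h x)
  · intro h x
    by_contra hn
    refine h (x + 1) ⟨x, by simp, ?_⟩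
    rwa [getD_pre _ (Nat.lt_succ_self x)]

end TameExtras

/-! ### Forcing with tame classes of reservoirs -/

section Forcing

variable {k r : ℕ} {I : Colouring k} {J : Colouring r} {S : Finset (Fin r)}

/-- A class of reservoirs whose members meet only the colours of `J` in `S`. -/
structure IsReservoirClass (I : Colouring k) (J : Colouring r) (S : Finset (Fin r))
    (P : Set (ℕ → Bool)) : Prop where
  nonempty : P.Nonempty
  tame : Tame I P
  infinite : ∀ X ∈ P, ∀ m, ∃ x ≥ m, X x = true
  colour : ∀ X ∈ P, ∀ x, X x = true → J x ∈ S

/-- The characteristic function of `F ∪ E`. -/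
def union (F : Finset ℕ) (E : ℕ → Bool) (x : ℕ) : Bool := decide (x ∈ F) || E x

/-- The part of the sequence `X` in `[b, ∞)`. -/
def cut (b : ℕ) (X : ℕ → Bool) (x : ℕ) : Bool := decide (b ≤ x) && X x

/-- The part of the coloured set `Z` of colour `i`. -/
def piece (i : Fin r) (Z : ℕ → Bool × Fin r) (x : ℕ) : Bool := (Z x).1 && decide ((Z x).2 = i)

theorem IsReservoirClass.cut {P : Set (ℕ → Bool)} (hP : IsReservoirClass I J S P) (b : ℕ) :
    IsReservoirClass I J S (cut b '' P) where
  nonempty := hP.nonempty.image _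
  tame := hP.tame.map (θ := fun x a => decide (b ≤ x) && a)
    (Primrec.and.comp (Primrec.nat_le.decide.comp (Primrec.const b) Primrec.fst) Primrec.snd)
  infinite := by
    rintro _ ⟨X, hX, rfl⟩ m
    obtain ⟨x, hx, hX⟩ := hP.infinite X hX (max b m)
    exact ⟨x, le_of_max_le_right hx, by simp [RamseySingletons.cut, hX, le_of_max_le_left hx]⟩
  colour := by
    rintro _ ⟨X, hX, rfl⟩ x hx
    exact hP.colour X hX x (by simp_all [RamseySingletons.cut])

theorem IsReservoirClass.superset {P : Set (ℕ → Bool)} (hP : IsReservoirClass I J S P)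
    {E : Finset ℕ} (h : ∃ X ∈ P, ∀ x ∈ E, X x = true) :
    IsReservoirClass I J S {X ∈ P | ∀ x ∈ E, X x = true} where
  nonempty := h
  tame := by
    have hA : PrimrecRel fun (x : ℕ) (a : Bool) => ¬ (∃ y ∈ E, x = y) ∨ a = true :=
      (PrimrecPred.finite_exists E fun y _ => Primrec.eq.comp Primrec.fst (Primrec.const y)).not.or
        (Primrec.eq.comp Primrec.snd (Primrec.const true))
    have := hP.tame.forall_term hA
    convert this using 5 with X x
    simp [imp_iff_not_or]
  infinite X hX := hP.infinite X hX.1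
  colour X hX := hP.colour X hX.1

/-- A forcing condition: finite approximations `F i` of the sets under construction, and a class
`P` of reservoirs from which all further elements are taken. -/
structure Cond (r : ℕ) where
  F : Fin r → Finset ℕ
  P : Set (ℕ → Bool)

structure Cond.Valid (I : Colouring k) (J : Colouring r) (S : Finset (Fin r)) (p : Cond r) :
    Prop where
  reservoir : IsReservoirClass I J S p.P
  colour : ∀ i, ∀ x ∈ p.F i, J x = i

/-- `q.Extends p`: the condition `q` is stronger than `p`. -/
structure Cond.Extends (q p : Cond r) : Prop where
  subset : ∀ i, p.F i ⊆ q.F i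
  reservoir : ∀ Y ∈ q.P, ∃ X ∈ p.P, (∀ x, Y x = true → X x = true) ∧
    ∀ i, ∀ x ∈ q.F i, x ∈ p.F i ∨ X x = true

theorem Cond.Extends.refl (p : Cond r) : p.Extends p :=
  ⟨fun _ => subset_rfl, fun Y hY => ⟨Y, hY, fun _ => id, fun _ _ => Or.inl⟩⟩

theorem Cond.Extends.trans {p q s : Cond r} (h₁ : s.Extends q) (h₂ : q.Extends p) :
    s.Extends p := by
  refine ⟨fun i => (h₂.subset i).trans (h₁.subset i), fun Z hZ => ?_⟩
  obtain ⟨Y, hY, hZY, hs⟩ := h₁.reservoir Z hZ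
  obtain ⟨X, hX, hYX, hq⟩ := h₂.reservoir Y hY
  refine ⟨X, hX, fun x hx => hYX x (hZY x hx), fun i x hx => ?_⟩
  rcases hs i x hx with h | h
  · exact hq i x h
  · exact Or.inr (hYX x h)

/-- Keeping only reservoirs that contain E makes the new points legitimate for every reservoir left;
cutting at b freezes the sets below b. -/
theorem Cond.Valid.exists_extend {p : Cond r} (hp : p.Valid I J S) {X : ℕ → Bool} (hX : X ∈ p.P)
    (i : Fin r) {E : Finset ℕ} (hE : ∀ x ∈ E, X x = true ∧ J x = i) (b : ℕ) :
    ∃ q : Cond r, q.Valid I J S ∧ q.Extends p ∧ q.F i = p.F i ∪ E ∧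
      ∀ Y ∈ q.P, ∀ x, Y x = true → b ≤ x := by
  refine ⟨⟨Function.update p.F i (p.F i ∪ E), cut b '' {X ∈ p.P | ∀ x ∈ E, X x = true}⟩,
    ⟨(hp.reservoir.superset ⟨X, hX, fun x hx => (hE x hx).1⟩).cut b, fun i' x hx => ?_⟩,
    ⟨fun i' => ?_, ?_⟩, by simp, ?_⟩
  · by_cases h : i' = i
    · subst h
      simp only [Function.update_self, Finset.mem_union] at hx
      exact hx.elim (hp.colour _ x) fun h => (hE x h).2
    · simp only [ne_eq, h, not_false_eq_true, Function.update_of_ne] at hx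
      exact hp.colour _ x hx
  · by_cases h : i' = i
    · subst h
      simp [Finset.subset_union_left]
    · simp [h]
  · rintro _ ⟨Y, ⟨hY, hEY⟩, rfl⟩
    refine ⟨Y, hY, fun x hx => by simp_all [cut], fun i' x hx => ?_⟩
    by_cases h : i' = i
    · subst h
      simp only [Function.update_self, Finset.mem_union] at hx
      exact hx.imp_right (hEY x)
    · simp only [ne_eq, h, not_false_eq_true, Function.update_of_ne] at hx
      exact Or.inl hx
  · rintro _ ⟨Y, -, rfl⟩ x hx
    simp_all [cut]

/-- For some colour `i ∈ S`, the functional `U i` accepts an extension of `F i` by elements of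
colour `i` of the coloured set `Z`. -/
def CanAccept (S : Finset (Fin r)) (F : Fin r → Finset ℕ) (U : Fin r → List Bool → ℕ → Prop)
    (Z : ℕ → Bool × Fin r) (l n : ℕ) : Prop :=
  ∃ i ∈ S, ∃ E : ℕ → Bool, (∀ x, E x = true → piece i Z x = true) ∧ U i (pre (union (F i) E) l) n

/-- Only the part of E below l matters, so the quantifier over E becomes a search through finitely
many strings. -/
theorem exists_primrecRel_canAccept [Inhabited (Fin r)] (S : Finset (Fin r))
    (F : Fin r → Finset ℕ) {U : Fin r → List Bool → ℕ → Prop} (hU : ∀ i, PrimrecRel (U i)) :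
    ∃ V : List (Bool × Fin r) → ℕ → Prop, PrimrecRel V ∧
      ∀ Z l n, V (pre Z l) n ↔ CanAccept S F U Z l n := by
  let τ : Fin r → List (Bool × Fin r) → List Bool → List Bool := fun i ζ ε =>
    (List.range ζ.length).map fun x => decide (∃ y ∈ F i, x = y) ||
      (ε.getD x false && ((ζ.getD x default).1 && decide ((ζ.getD x default).2 = i)))
  have hτ (i : Fin r) : Primrec₂ (τ i) := by
    have h1 : PrimrecPred fun x : ℕ => ∃ y ∈ F i, x = y :=
      PrimrecPred.finite_exists _ fun y _ => Primrec.eq.comp Primrec.id (Primrec.const y)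
    have h2 : Primrec fun q : (List (Bool × Fin r) × List Bool) × ℕ => q.1.1.getD q.2 default :=
      (Primrec.list_getD _).comp (Primrec.fst.comp Primrec.fst) Primrec.snd
    refine Primrec.list_map (Primrec.list_range.comp (Primrec.list_length.comp Primrec.fst)) ?_
    refine Primrec.or.comp ?_ (Primrec.and.comp
      ((Primrec.list_getD false).comp (Primrec.snd.comp Primrec.fst) Primrec.snd)
      (Primrec.and.comp (Primrec.fst.comp h2)
        (Primrec.eq.decide.comp (Primrec.snd.comp h2) (Primrec.const i))))
    exact (h1.comp Primrec.snd).decide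
  have hτpre (i : Fin r) (Z : ℕ → Bool × Fin r) (E : ℕ → Bool) (l : ℕ) :
      τ i (pre Z l) (pre E l) = pre (union (F i) fun x => E x && piece i Z x) l := by
    simp only [τ, length_pre]
    exact pre_congr fun x hx => by
      simp only [getD_pre _ hx, union, piece, exists_eq_right']
  refine ⟨fun ζ n => ∃ i ∈ S, ∃ ε ∈ stringsOfLength [true, false] ζ.length, U i (τ i ζ ε) n,
    PrimrecPred.finite_exists S fun i _ => PrimrecRel.exists_mem
      (R := fun (q : List (Bool × Fin r) × ℕ) ε => U i (τ i q.1 ε) q.2)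
      ((hU i).comp ((hτ i).comp (Primrec.fst.comp Primrec.fst) Primrec.snd)
        (Primrec.snd.comp Primrec.fst))
      ((primrec_stringsOfLength _).comp (Primrec.list_length.comp Primrec.fst)),
    fun Z l n => ?_⟩
  have hL : ∀ b : Bool, b ∈ [true, false] := by decide
  constructor
  · rintro ⟨i, hi, ε, hε, hu⟩
    rw [mem_stringsOfLength hL, length_pre] at hε
    have : ε = pre (fun x => ε.getD x false) l := by
      apply List.ext_getElem (by simp [hε])
      intro x h1 h2
      simp [pre, h1]
    rw [this, hτpre] at hu
    exact ⟨i, hi, _, fun x hx => (Bool.and_eq_true _ _ ▸ hx).2, hu⟩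
  · rintro ⟨i, hi, E, hE, hu⟩
    refine ⟨i, hi, pre E l, by simp [mem_stringsOfLength hL], ?_⟩
    rw [hτpre]
    convert hu using 3
    funext x
    have := hE x
    cases h : E x <;> simp_all

/-- The condition `q` decides, for the `i`-th set under construction, the requirement given by the
functional `U` and the colour `j`. -/
def Cond.Decides (I : Colouring k) (q : Cond r) (i : Fin r) (U : List Bool → ℕ → Prop)
    (j : Fin k) : Prop :=
  ∃ n, (∀ Y ∈ q.P, ∀ E : ℕ → Bool, (∀ x, E x = true → Y x = true) →
      ∀ l, ¬ U (pre (union (q.F i) E) l) n) ∨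
    ∃ l, (∀ x, n ≤ x → x ≤ l → I x = j) ∧
      ∀ Y ∈ q.P, ∀ E : ℕ → Bool, (∀ x, E x = true → Y x = true) →
        U (pre (union (q.F i) E) l) n

/-- The search runs over reservoirs with arbitrary colourings into S. If it always succeeds, it
succeeds in particular for `J`, with a tame bound; if it fails for some n, a coloured reservoir
witnessing the failure has an infinite piece, on which acceptance above n is blocked for good. -/
theorem Cond.Valid.exists_decides {p : Cond r} (hp : p.Valid I J S)
    {U : Fin r → List Bool → ℕ → Prop} (hU : ∀ i, PrimrecRel (U i)) (j : Fin k) :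
    ∃ q : Cond r, q.Valid I J S ∧ q.Extends p ∧ ∃ i ∈ S, q.Decides I i (U i) j := by
  classical
  have : Inhabited (Fin r) := ⟨J 0⟩
  obtain ⟨V, hV, hVZ⟩ := exists_primrecRel_canAccept S p.F hU
  let Q₀ : Set (ℕ → Bool × Fin r) :=
    {Z ∈ {Z | (fun x => (Z x).1) ∈ p.P} | ∀ x, (Z x).1 = true → (Z x).2 ∈ S}
  have hQ₀ : Tame I Q₀ := hp.reservoir.tame.prod.forall_term
    (A := fun _ (a : Bool × Fin r) => a.1 = true → a.2 ∈ S)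
    ((PrimrecPred.of_finite fun a : Bool × Fin r => a.1 = true → a.2 ∈ S).comp Primrec.snd)
  by_cases hcase : ∀ n, ∀ Z ∈ Q₀, ∃ l, V (pre Z l) n
  · obtain ⟨n, g, hc, hg⟩ := hQ₀ V hV hcase j
    obtain ⟨X, hX⟩ := hp.reservoir.nonempty
    -- The bound holds for all colourings, so the true colouring `J` may now be inserted.
    obtain ⟨l, hl, hv⟩ := hg (fun x => (X x, J x)) ⟨hX, hp.reservoir.colour X hX⟩
    obtain ⟨i, hi, E, hE, hu⟩ := (hVZ _ _ _).1 hv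
    have hE' : ∀ x ∈ (Finset.range l).filter fun x => E x = true, X x = true ∧ J x = i := by
      intro x hx
      simpa [piece] using hE x (Finset.mem_filter.1 hx).2
    obtain ⟨q, hq, hqp, hF, hb⟩ := hp.exists_extend hX i hE' l
    refine ⟨q, hq, hqp, i, hi, n, Or.inr ⟨l, fun x h1 h2 => hc x h1 (h2.trans hl),
      fun Y hY E' hE' => ?_⟩⟩
    rw [pre_congr (Y := union (p.F i) E)]
    · exact hu
    · intro x hx
      have : E' x = false := by
        by_contra h
        have := hb Y hY x (hE' x (by simpa using h))
        omega
      simp [union, hF, this, hx]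
  · push Not at hcase
    obtain ⟨n, Z₀, hZ₀, hZ₀'⟩ := hcase
    -- The counterexamples in which no colour of T is used from m on. A maximal T makes every other
    -- piece infinite in all members at once.
    let R : Finset (Fin r) → ℕ → Set (ℕ → Bool × Fin r) := fun T m =>
      {Z ∈ {Z ∈ Q₀ | ∀ l, ¬ V (pre Z l) n} | ∀ x, m ≤ x → (Z x).1 = true → (Z x).2 ∉ T}
    have hR (T : Finset (Fin r)) (m : ℕ) : Tame I (R T m) := by
      refine (hQ₀.restrict (hV.comp Primrec.id (Primrec.const n))).forall_term
        (A := fun x (a : Bool × Fin r) => m ≤ x → a.1 = true → a.2 ∉ T) ?_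
      exact ((Primrec.nat_le.comp (Primrec.const m) Primrec.fst).not.or
        ((PrimrecPred.of_finite fun a : Bool × Fin r => a.1 = true → a.2 ∉ T).comp
          Primrec.snd)).of_eq fun a => imp_iff_not_or.symm
    obtain ⟨T, hT, hmax⟩ := (S.powerset.filter fun T => ∃ m, (R T m).Nonempty).exists_max_image
      Finset.card ⟨∅, by simpa using ⟨0, Z₀, ⟨hZ₀, hZ₀'⟩, by simp⟩⟩
    rw [Finset.mem_filter, Finset.mem_powerset] at hT
    obtain ⟨hTS, m, Z₁, hZ₁⟩ := hT
    obtain ⟨x, hx, hZx⟩ := hp.reservoir.infinite _ hZ₁.1.1.1 m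
    obtain ⟨i, hi, hiT⟩ : ∃ i ∈ S, i ∉ T := ⟨_, hZ₁.1.1.2 x hZx, hZ₁.2 x hx hZx⟩
    refine ⟨⟨p.F, piece i '' R T m⟩, ⟨⟨⟨_, Z₁, hZ₁, rfl⟩, ?_, ?_, ?_⟩, hp.colour⟩,
      ⟨fun _ => subset_rfl, ?_⟩, i, hi, n, Or.inl ?_⟩
    · exact (hR T m).map (θ := fun _ (a : Bool × Fin r) => a.1 && decide (a.2 = i))
        ((Primrec.dom_finite fun a : Bool × Fin r => a.1 && decide (a.2 = i)).comp Primrec.snd)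
    · rintro _ ⟨Z, hZ, rfl⟩ m'
      by_contra hn
      push Not at hn
      -- A piece i empty beyond m' would allow i to be added to T, against maximality.
      have : insert i T ∈ S.powerset.filter fun T => ∃ m, (R T m).Nonempty := by
        rw [Finset.mem_filter, Finset.mem_powerset]
        refine ⟨Finset.insert_subset hi hTS, max m m', Z, hZ.1, fun x hx h1 h2 => ?_⟩
        rcases Finset.mem_insert.1 h2 with h2 | h2
        · exact hn x (le_of_max_le_right hx) (by simp [piece, h1, h2])
        · exact hZ.2 x (le_of_max_le_left hx) h1 h2
      have := hmax _ this
      rw [Finset.card_insert_of_notMem hiT] at this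
      omega
    · rintro _ ⟨Z, hZ, rfl⟩ x hx
      exact hp.reservoir.colour _ hZ.1.1.1 x (by simp_all [piece])
    · rintro _ ⟨Z, hZ, rfl⟩
      exact ⟨_, hZ.1.1.1, fun x hx => by simp_all [piece], fun _ _ => Or.inl⟩
    · rintro _ ⟨Z, hZ, rfl⟩ E hE l hu
      exact hZ.1.2 l ((hVZ _ _ _).2 ⟨i, hi, E, hE, hu⟩)

/-- Take S of least size. If no member of P had a point of colour i beyond m, cutting at m would
give a class for S without i. This is what lets `G i` be made infinite for i in S. -/
theorem exists_minimal_reservoirClass (hI : Fickle I) (J : Colouring r) :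
    ∃ S : Finset (Fin r), (∃ P, IsReservoirClass I J S P) ∧
      ∀ P, IsReservoirClass I J S P → ∀ i ∈ S, ∀ m, ∃ X ∈ P, ∃ x ≥ m, X x = true ∧ J x = i := by
  classical
  have h0 : IsReservoirClass I J Finset.univ {fun _ => true} :=
    ⟨⟨_, rfl⟩, tame_singleton_const hI true, by rintro X rfl m; exact ⟨m, le_rfl, rfl⟩, by simp⟩
  obtain ⟨S, hS, hmin⟩ := (Finset.univ.filter fun S : Finset (Fin r) =>
    ∃ P, IsReservoirClass I J S P).exists_min_image Finset.card ⟨Finset.univ, by simpa using ⟨_, h0⟩⟩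
  refine ⟨S, by simpa using hS, fun P hP i hi m => ?_⟩
  by_contra hn
  push Not at hn
  have hc := hP.cut m
  have : IsReservoirClass I J (S.erase i) (cut m '' P) := by
    refine ⟨hc.nonempty, hc.tame, hc.infinite, ?_⟩
    rintro _ ⟨X, hX, rfl⟩ x hx
    rw [cut, Bool.and_eq_true, decide_eq_true_eq] at hx
    exact Finset.mem_erase.2 ⟨hn X hX x hx.1 hx.2, hP.colour X hX x hx.2⟩
  have := hmin (S.erase i) (by simpa using ⟨_, this⟩)
  rw [Finset.card_erase_of_mem hi] at this
  have := Finset.card_pos.2 ⟨i, hi⟩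
  omega

/-- A generic sequence of conditions produces homogeneous sets that decide all requirements. -/
theorem exists_generic (hI : Fickle I) (J : Colouring r) :
    ∃ (S : Finset (Fin r)) (G : Fin r → ℕ → Bool),
      (∀ i ∈ S, {x | G i x = true}.Infinite) ∧ (∀ i x, G i x = true → J x = i) ∧
      ∀ (j : Fin k) (c : Fin r → Code), ∃ i ∈ S, ∃ n,
        (∀ l, ¬ AcceptsAbove (c i) (pre (G i) l) n) ∨
        ∃ l, AcceptsAbove (c i) (pre (G i) l) n ∧ ∀ x, n ≤ x → x ≤ l → I x = j := by
  obtain ⟨S, ⟨P, hP⟩, hS⟩ := exists_minimal_reservoirClass hI J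
  -- There are countably many tasks: put a point beyond m into `G i`, or decide colour j for a tuple
  -- of codes.
  let Task := (Fin r × ℕ) ⊕ (Fin k × (Fin r → Code))
  let Meets : Task → Cond r → Prop := Sum.elim
    (fun t q => t.1 ∈ S → ∃ x ≥ t.2, x ∈ q.F t.1)
    (fun t q => ∃ i ∈ S, q.Decides I i (AcceptsAbove (t.2 i)) t.1)
  have hmeet (t : Task) (p : {p : Cond r // p.Valid I J S}) :
      ∃ q : {p : Cond r // p.Valid I J S}, q.1.Extends p.1 ∧ Meets t q.1 := by
    rcases t with ⟨i, m⟩ | ⟨j, c⟩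
    · by_cases hi : i ∈ S
      · obtain ⟨X, hX, x, hx, hXx, hJ⟩ := hS _ p.2.reservoir i hi m
        obtain ⟨q, hq, hqp, hF, -⟩ := p.2.exists_extend hX i (E := {x}) (by simp [hXx, hJ]) 0
        exact ⟨⟨q, hq⟩, hqp, fun _ => ⟨x, hx, by simp [hF]⟩⟩
      · exact ⟨p, .refl _, fun h => absurd h hi⟩
    · obtain ⟨q, hq, hqp, h⟩ := p.2.exists_decides (fun i => primrecRel_acceptsAbove (c i)) j
      exact ⟨⟨q, hq⟩, hqp, h⟩
  choose next hext hnext using hmeet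
  have : Nonempty Task := ⟨Sum.inl (J 0, 0)⟩
  obtain ⟨task, htask⟩ := exists_surjective_nat Task
  let seq : ℕ → {p : Cond r // p.Valid I J S} := fun t =>
    t.rec ⟨⟨fun _ => ∅, P⟩, hP, by simp⟩ fun t p => next (task t) p
  have hseq (t : ℕ) : seq (t + 1) = next (task t) (seq t) := rfl
  have hmono {s t : ℕ} (h : s ≤ t) : (seq t).1.Extends (seq s).1 := by
    induction t, h using Nat.le_induction with
    | base => exact .refl _
    | succ t _ ih => exact (hseq t ▸ hext (task t) (seq t)).trans ih
  have hmeets (t : Task) : ∃ s, Meets t (seq s).1 := by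
    obtain ⟨s, rfl⟩ := htask t
    exact ⟨s + 1, hseq s ▸ hnext (task s) (seq s)⟩
  classical
  let G : Fin r → ℕ → Bool := fun i x => decide (∃ t, x ∈ (seq t).1.F i)
  have hfin (i : Fin r) (l s : ℕ) : ∃ t ≥ s, ∀ x < l, G i x = true → x ∈ (seq t).1.F i := by
    induction l with
    | zero => exact ⟨s, le_rfl, by simp⟩
    | succ l ih =>
      obtain ⟨t, hts, ht⟩ := ih
      by_cases hl : ∃ u, l ∈ (seq u).1.F i
      · obtain ⟨u, hu⟩ := hl
        refine ⟨max t u, hts.trans (le_max_left _ _), fun x hx hGx => ?_⟩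
        rcases Nat.lt_succ_iff_lt_or_eq.1 hx with hx | rfl
        · exact (hmono (le_max_left t u)).subset i (ht x hx hGx)
        · exact (hmono (le_max_right t u)).subset i hu
      · refine ⟨t, hts, fun x hx hGx => ?_⟩
        rcases Nat.lt_succ_iff_lt_or_eq.1 hx with hx | rfl
        · exact ht x hx hGx
        · exact absurd (by simpa [G] using hGx) hl
  -- Up to any length, `G i` looks like a union allowed by the condition at stage s, so whatever
  -- that condition decides holds of `G i`.
  have hcompat (i : Fin r) (s l : ℕ) : ∃ Y ∈ (seq s).1.P, ∃ E : ℕ → Bool,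
      (∀ x, E x = true → Y x = true) ∧ pre (G i) l = pre (union ((seq s).1.F i) E) l := by
    obtain ⟨t, hst, ht⟩ := hfin i l s
    obtain ⟨X, hX⟩ := (seq t).2.reservoir.nonempty
    obtain ⟨Y, hY, -, hF⟩ := (hmono hst).reservoir X hX
    refine ⟨Y, hY, fun x => decide (x ∈ (seq t).1.F i ∧ Y x = true), fun x hx => by simp_all,
      pre_congr fun x hx => Bool.eq_iff_iff.2 ⟨fun h => ?_, fun h => ?_⟩⟩
    · have hxt := ht x hx h
      rcases hF i x hxt with h | h <;> simp [union, h, hxt]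
    · have : x ∈ (seq s).1.F i ∨ x ∈ (seq t).1.F i := by
        simp only [union, Bool.or_eq_true, decide_eq_true_eq] at h
        exact h.imp_right And.left
      rcases this with h | h
      · exact decide_eq_true ⟨s, h⟩
      · exact decide_eq_true ⟨t, h⟩
  refine ⟨S, G, fun i hi => ?_, fun i x hx => ?_, fun j c => ?_⟩
  · refine Set.infinite_of_forall_exists_gt fun m => ?_
    obtain ⟨t, ht⟩ := hmeets (Sum.inl (i, m + 1))
    obtain ⟨x, hx, hF⟩ := ht hi
    exact ⟨x, decide_eq_true ⟨t, hF⟩, hx⟩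
  · obtain ⟨t, ht⟩ := of_decide_eq_true hx
    exact (seq t).2.colour i x ht
  · obtain ⟨t, i, hi, n, h⟩ := hmeets (Sum.inr (j, c))
    refine ⟨i, hi, n, h.imp (fun h l => ?_) ?_⟩
    · obtain ⟨Y, hY, E, hE, he⟩ := hcompat i t l
      rw [he]
      exact h Y hY E hE l
    · rintro ⟨l, hc, h⟩
      obtain ⟨Y, hY, E, hE, he⟩ := hcompat i t l
      exact ⟨l, he ▸ h Y hY E hE, hc⟩

end Forcing

end RamseySingletons

/-! ### The pigeonhole argument -/

theorem mainTheorem3 (k : ℕ) (hk : 2 ≤ k) :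
    ∃ I : RamseySingletons.Colouring k,
      ComputableIn {RamseySingletons.charFun RamseySingletons.zeroJump} I ∧
      ∀ J : RamseySingletons.Colouring (k - 1),
        ∃ G : Set ℕ, RamseySingletons.IsSolution J G ∧
          ∀ H : Set ℕ, RamseySingletons.IsSolution I H →
            ¬ RamseySingletons.Computes G H := by
  obtain ⟨I, hIc, hI⟩ := RamseySingletons.exists_fickle (k := k) (by omega)
  refine ⟨I, hIc, fun J => ?_⟩
  obtain ⟨S, G, hinf, hcol, hdec⟩ := RamseySingletons.exists_generic hI J
  let Sat : Fin k → Fin (k - 1) → Nat.Partrec.Code → Prop := fun j i c => ∃ n,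
    (∀ l, ¬ RamseySingletons.AcceptsAbove c (RamseySingletons.pre (G i) l) n) ∨
      ∃ l, RamseySingletons.AcceptsAbove c (RamseySingletons.pre (G i) l) n ∧
        ∀ x, n ≤ x → x ≤ l → I x = j
  -- If each i in S failed for some code, the tuple of these codes would contradict `hdec`.
  have hall (j : Fin k) : ∃ i ∈ S, ∀ c, Sat j i c := by
    by_contra hn
    push Not at hn
    have : ∀ i, ∃ c, i ∈ S → ¬ Sat j i c := fun i => by
      by_cases hi : i ∈ S
      · exact (hn i hi).imp fun c hc _ => hc
      · exact ⟨.zero, fun h => absurd h hi⟩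
    choose c hc using this
    obtain ⟨i, hi, h⟩ := hdec j c
    exact hc i hi h
  choose f hfS hf using hall
  obtain ⟨j, j', hne, heq⟩ := Fintype.exists_ne_map_eq_of_card_lt f (by simp; omega)
  refine ⟨{x | G (f j) x = true}, ⟨hinf _ (hfS j), f j, fun x hx => hcol _ x hx⟩, ?_⟩
  rintro H ⟨hH, a, ha⟩ hcomp
  obtain ⟨c, hc₁, hc₂⟩ := RamseySingletons.exists_code_acceptsAbove hcomp
  -- Both j and j' are handled by the same set, and at least one of them differs from the colour a
  -- of H.
  obtain ⟨b, hba, n, hb⟩ : ∃ b, b ≠ a ∧ Sat b (f j) c := by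
    by_cases h : j = a
    · exact ⟨j', fun h' => hne (h.trans h'.symm), heq ▸ hf j' c⟩
    · exact ⟨j, h, hf j c⟩
  rcases hb with hb | ⟨l, hl, hb⟩
  · obtain ⟨x, hx, hnx⟩ := hH.exists_gt n
    obtain ⟨l, hl⟩ := hc₁ n x hx hnx.le
    exact hb l hl
  · obtain ⟨x, hx, h1, h2⟩ := hc₂ n l hl
    exact hba ((hb x h1 h2).symm.trans (ha x hx))
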